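/- Let $J$ be a compact (Hausdorff) smooth manifold without boundary, of dimension $k$, with a smooth involution $\iota_J$ whose fixed point set is nonempty and consists of isolated points. A \emph{quaternionic bundle} over $J$ is a complex vector bundle $E\to J$ with a fibrewise conjugate-linear lift $\iota_E:E\to E$ of $\iota_J$ satisfying $\iota_E\circ\iota_E=-1$; its rank is its complex rank. Let $Pin(2)$ be the group generated by $U(1)$ and a symbol $\iota$ with $\iota^2=-1$ and $\iota z\iota^{-1}=z^{-1}$ for $z\in U(1)$; it acts on $E$, with $z\in U(1)$ acting by complex multiplication and $\iota$ acting by $\iota_E$. Let $\underline{\mathbb H}^m$ be the quaternionic bundle $J\times{\mathbb H}^m$, where complex numbers act on ${\mathbb H}^m$ by multiplication on the right and $\iota(x,q)=(\iota_J x,q\mathbf j)$. Theorem. Let $E$ be a quaternionic bundle over $J$ of rank $2l$, and let $m=l+\left\lfloor\frac{k+2}{4}\right\rfloor$. Then there is a $Pin(2)$-equivariant monomorphism $E\to\underline{\mathbb H}^m$, that is, a (continuous) homomorphism of complex vector bundles over the identity of $J$ which is injective on every fibre and commutes with the actions of $Pin(2)$. If the bundle $E$ and the map $\iota_E$ are smooth,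 then the monomorphism can be chosen to be smooth. -/

import Mathlib

open Bundle Function
open scoped Manifold ContDiff Quaternion

/-! ### The group `Pin(2)` -/

/-- `Pin(2)`, the group generated by `U(1)` and a symbol `ι` with `ι² = -1` and
`ι z ι⁻¹ = z⁻¹` for `z ∈ U(1)`.  Every element is uniquely `z` or `z ι` with `z ∈ U(1)`;
`rot z` stands for `z` and `flip z` for `z ι`. -/
inductive Pin2 : Type
  | rot (z : Circle) : Pin2
  | flip (z : Circle) : Pin2

namespace Pin2

/-- The product: `(z ι) w = (z w⁻¹) ι` and `(z ι)(w ι) = - z w⁻¹`. -/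
protected noncomputable def mul : Pin2 → Pin2 → Pin2
  | rot z, rot w => rot (z * w)
  | rot z, flip w => flip (z * w)
  | flip z, rot w => flip (z * w⁻¹)
  | flip z, flip w => rot (-(z * w⁻¹))

/-- The inverse: `(z ι)⁻¹ = (-z) ι`. -/
protected noncomputable def inv : Pin2 → Pin2
  | rot z => rot z⁻¹
  | flip z => flip (-z)

noncomputable instance : Mul Pin2 := ⟨Pin2.mul⟩
noncomputable instance : One Pin2 := ⟨rot 1⟩
noncomputable instance : Inv Pin2 := ⟨Pin2.inv⟩

theorem rot_mul_rot (z w : Circle) : rot z * rot w = rot (z * w) := rfl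
theorem rot_mul_flip (z w : Circle) : rot z * flip w = flip (z * w) := rfl
theorem flip_mul_rot (z w : Circle) : flip z * rot w = flip (z * w⁻¹) := rfl
theorem flip_mul_flip (z w : Circle) : flip z * flip w = rot (-(z * w⁻¹)) := rfl
theorem one_def : (1 : Pin2) = rot 1 := rfl
theorem inv_rot (z : Circle) : (rot z)⁻¹ = rot z⁻¹ := rfl
theorem inv_flip (z : Circle) : (flip z)⁻¹ = flip (-z) := rfl

theorem circle_inv_neg (z : Circle) : (-z)⁻¹ = -z⁻¹ := by
  rw [inv_eq_iff_mul_eq_one]; simp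

noncomputable instance : Group Pin2 :=
  Group.ofLeftAxioms
    (by
      rintro (a | a) (b | b) (c | c) <;>
        simp only [rot_mul_rot, rot_mul_flip, flip_mul_rot, flip_mul_flip, circle_inv_neg,
          mul_inv, inv_inv, mul_assoc, neg_mul, mul_neg])
    (by rintro (a | a) <;> simp [one_def, rot_mul_rot, rot_mul_flip])
    (by rintro (a | a) <;>
        simp [one_def, inv_rot, inv_flip, rot_mul_rot, flip_mul_flip])

end Pin2

/-! ### Quaternionic bundles -/

section QuaternionicBundle

variable {J : Type*} (ιJ : J → J)
  (F : Type*) [NormedAddCommGroup F] [NormedSpace ℂ F]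
  (E : J → Type*) [∀ x, AddCommGroup (E x)] [∀ x, Module ℂ (E x)]
  [TopologicalSpace (TotalSpace F E)]

/-- A quaternionic structure on a complex vector bundle `E` (with typical fibre `F`) over a space
`J` with involution `ιJ`: a continuous, fibrewise conjugate-linear lift `ι_E` of `ιJ` to the
total space of `E`, with `ι_E ∘ ι_E = -1`. -/
structure QuaternionicStructure where
  /-- the restriction `E_x → E_{ιJ x}` of `ι_E` -/
  fiberMap : ∀ x, E x →ₛₗ[starRingEnd ℂ] E (ιJ x)
  continuous_total : Continuous
    (fun u : TotalSpace F E => (⟨ιJ u.proj, fiberMap u.proj u.2⟩ : TotalSpace F E))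
  sq_eq_neg : ∀ (x : J) (v : E x),
    (⟨ιJ (ιJ x), fiberMap (ιJ x) (fiberMap x v)⟩ : TotalSpace F E) = ⟨x, -v⟩

variable {ιJ F E}

namespace QuaternionicStructure

/-- The map `ι_E` on the total space. -/
def total (Q : QuaternionicStructure ιJ F E) (u : TotalSpace F E) : TotalSpace F E :=
  ⟨ιJ u.proj, Q.fiberMap u.proj u.2⟩

/-- The action of `Pin(2)` on the total space of a quaternionic bundle: `U(1)` acts by complex
multiplication in the fibres, and the generator `ι` acts by `ι_E`. -/
def act (Q : QuaternionicStructure ιJ F E) : Pin2 → TotalSpace F E → TotalSpace F E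
  | Pin2.rot z, u => ⟨u.proj, (z : ℂ) • u.2⟩
  | Pin2.flip z, u => ⟨ιJ u.proj, (z : ℂ) • Q.fiberMap u.proj u.2⟩

/-- `act` is a group action. -/
@[reducible] def mulAction (Q : QuaternionicStructure ιJ F E) :
    MulAction Pin2 (TotalSpace F E) where
  smul := Q.act
  one_smul u := by
    change Q.act (Pin2.rot 1) u = u
    simp [act]
  mul_smul g h u := by
    change Q.act (g * h) u = Q.act g (Q.act h u)
    obtain ⟨x, v⟩ := u
    rcases g with z | z <;> rcases h with w | w
    · change (⟨x, ((z * w : Circle) : ℂ) • v⟩ : TotalSpace F E) = ⟨x, (z : ℂ) • (w : ℂ) • v⟩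
      rw [Circle.coe_mul, mul_smul]
    · change (⟨ιJ x, ((z * w : Circle) : ℂ) • Q.fiberMap x v⟩ : TotalSpace F E) =
        ⟨ιJ x, (z : ℂ) • (w : ℂ) • Q.fiberMap x v⟩
      rw [Circle.coe_mul, mul_smul]
    · change (⟨ιJ x, ((z * w⁻¹ : Circle) : ℂ) • Q.fiberMap x v⟩ : TotalSpace F E) =
        ⟨ιJ x, (z : ℂ) • Q.fiberMap x ((w : ℂ) • v)⟩
      rw [Circle.coe_mul, mul_smul, map_smulₛₗ, Circle.coe_inv_eq_conj]
    · have h := congrArg (fun u : TotalSpace F E =>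
        (⟨u.proj, ((z : ℂ) * starRingEnd ℂ (w : ℂ)) • u.2⟩ : TotalSpace F E)) (Q.sq_eq_neg x v)
      change (⟨x, ((-(z * w⁻¹) : Circle) : ℂ) • v⟩ : TotalSpace F E) =
        ⟨ιJ (ιJ x), (z : ℂ) • Q.fiberMap (ιJ x) ((w : ℂ) • Q.fiberMap x v)⟩
      rw [map_smulₛₗ, smul_smul]
      refine Eq.trans ?_ h.symm
      change _ = (⟨x, ((z : ℂ) * starRingEnd ℂ (w : ℂ)) • -v⟩ : TotalSpace F E)
      rw [smul_neg, ← neg_smul, ← Circle.coe_inv_eq_conj, ← Circle.coe_mul]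
      rfl

end QuaternionicStructure

end QuaternionicBundle

/-! ### The trivial quaternionic bundle -/

/-- The quaternionic space `ℍ^m`, regarded as a complex vector space of dimension `2m` in such a
way that right multiplication by `𝐣` is conjugate-linear: complex numbers act by multiplication
on the right. -/
def QuatSpace (m : ℕ) : Type := Fin m → ℍ[ℝ]

namespace QuatSpace

noncomputable instance (m : ℕ) : NormedAddCommGroup (QuatSpace m) :=
  inferInstanceAs (NormedAddCommGroup (Fin m → ℍ[ℝ]))

noncomputable instance (m : ℕ) : Module ℂ (QuatSpace m) where
  smul z q := fun i => q i * (z : ℍ[ℝ])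
  one_smul q := funext fun i => by
    change q i * ((1 : ℂ) : ℍ[ℝ]) = q i; simp
  mul_smul z w q := funext fun i => by
    change q i * ((z * w : ℂ) : ℍ[ℝ]) = q i * (w : ℍ[ℝ]) * (z : ℍ[ℝ])
    rw [mul_comm z w, Quaternion.coeComplex_mul, mul_assoc]
  smul_zero z := funext fun i => zero_mul _
  smul_add z p q := funext fun i => add_mul (p i) (q i) _
  add_smul z w q := funext fun i => by
    change q i * ((z + w : ℂ) : ℍ[ℝ]) = q i * (z : ℍ[ℝ]) + q i * (w : ℍ[ℝ])
    rw [Quaternion.coeComplex_add, mul_add]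
  zero_smul q := funext fun i => by
    change q i * ((0 : ℂ) : ℍ[ℝ]) = 0; simp

theorem smul_apply {m : ℕ} (z : ℂ) (q : QuatSpace m) (i : Fin m) :
    (z • q) i = q i * (z : ℍ[ℝ]) := rfl

theorem norm_coeComplex (z : ℂ) : ‖(z : ℍ[ℝ])‖ = ‖z‖ := by
  rw [← sq_eq_sq₀ (norm_nonneg _) (norm_nonneg _), sq, ← Quaternion.normSq_eq_norm_mul_self,
    Quaternion.normSq_def', Complex.sq_norm, Complex.normSq_apply]
  simp [sq]

noncomputable instance (m : ℕ) : NormedSpace ℂ (QuatSpace m) where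
  norm_smul_le z q := by
    refine (pi_norm_le_iff_of_nonneg (mul_nonneg (norm_nonneg _) (norm_nonneg _))).2 fun i => ?_
    change ‖q i * (z : ℍ[ℝ])‖ ≤ _
    rw [norm_mul, norm_coeComplex, mul_comm]
    exact mul_le_mul_of_nonneg_left (norm_le_pi_norm (f := (q : Fin m → ℍ[ℝ])) i) (norm_nonneg z)

/-- The quaternion unit `𝐣`. -/
def jj : ℍ[ℝ] := ⟨0, 0, 1, 0⟩

theorem coe_mul_jj (z : ℂ) : (z : ℍ[ℝ]) * jj = jj * ((starRingEnd ℂ z : ℂ) : ℍ[ℝ]) := by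
  ext <;> simp only [Quaternion.re_mul, Quaternion.imI_mul, Quaternion.imJ_mul,
    Quaternion.imK_mul] <;> simp [jj]

theorem jj_mul_jj : jj * jj = -1 := by
  ext <;> simp only [Quaternion.re_mul, Quaternion.imI_mul, Quaternion.imJ_mul,
    Quaternion.imK_mul] <;> simp [jj]

/-- Right multiplication by `𝐣`, a conjugate-linear map. -/
noncomputable def mulJ (m : ℕ) : QuatSpace m →ₛₗ[starRingEnd ℂ] QuatSpace m where
  toFun q := fun i => q i * jj
  map_add' p q := funext fun i => add_mul (p i) (q i) _
  map_smul' z q := funext fun i => by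
    change q i * (z : ℍ[ℝ]) * jj = q i * jj * ((starRingEnd ℂ z : ℂ) : ℍ[ℝ])
    rw [mul_assoc, coe_mul_jj, mul_assoc]

theorem mulJ_mulJ {m : ℕ} (q : QuatSpace m) : mulJ m (mulJ m q) = -q :=
  funext fun i => by
    change q i * jj * jj = -(q i)
    rw [mul_assoc, jj_mul_jj, mul_neg, mul_one]

end QuatSpace

/-- The trivial quaternionic bundle `J × ℍ^m`, with `ι (x, q) = (ιJ x, q 𝐣)`. -/
noncomputable def trivialQuaternionic {J : Type*} [TopologicalSpace J] (ιJ : J → J)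
    (hc : Continuous ιJ) (hinv : Involutive ιJ) (m : ℕ) :
    QuaternionicStructure ιJ (QuatSpace m) (Bundle.Trivial J (QuatSpace m)) where
  fiberMap _ := QuatSpace.mulJ m
  continuous_total := by
    have hJ : Continuous (QuatSpace.mulJ m) :=
      continuous_pi fun i => (continuous_apply i).mul continuous_const
    refine (Bundle.Trivial.homeomorphProd J (QuatSpace m)).symm.continuous.comp
      ((hc.prodMap hJ).comp (Bundle.Trivial.homeomorphProd J (QuatSpace m)).continuous)
  sq_eq_neg x v := by
    have h : QuatSpace.mulJ m (QuatSpace.mulJ m v) = -v := QuatSpace.mulJ_mulJ v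
    change (⟨ιJ (ιJ x), QuatSpace.mulJ m (QuatSpace.mulJ m v)⟩ :
      TotalSpace (QuatSpace m) (Bundle.Trivial J (QuatSpace m))) = ⟨x, -v⟩
    rw [h, hinv x]

/-! ### Monomorphisms -/

section Mono

variable {J : Type*}
  {F : Type*} [NormedAddCommGroup F] [NormedSpace ℂ F]
  {E : J → Type*} [∀ x, AddCommGroup (E x)] [∀ x, Module ℂ (E x)]
  [TopologicalSpace (TotalSpace F E)]
  {F' : Type*} [NormedAddCommGroup F'] [NormedSpace ℂ F']
  {E' : J → Type*} [∀ x, AddCommGroup (E' x)] [∀ x, Module ℂ (E' x)]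
  [TopologicalSpace (TotalSpace F' E')]

variable (F F') in
/-- The map of total spaces, over the identity of `J`, given by a family of linear maps. -/
def totalMap (Φ : ∀ x, E x →ₗ[ℂ] E' x) (u : TotalSpace F E) : TotalSpace F' E' :=
  ⟨u.proj, Φ u.proj u.2⟩

/-- `Φ` is a `Pin(2)`-equivariant monomorphism of quaternionic bundles: a continuous map of complex
vector bundles over the identity of `J` that is injective on each fibre and commutes with the
`Pin(2)`-actions. -/
structure IsPin2Monomorphism {ιJ : J → J} (Q : QuaternionicStructure ιJ F E)
    (Q' : QuaternionicStructure ιJ F' E') (Φ : ∀ x, E x →ₗ[ℂ] E' x) : Prop where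
  continuous : Continuous (totalMap F F' Φ)
  injective : ∀ x, Injective (Φ x)
  equivariant : ∀ (g : Pin2) (u : TotalSpace F E),
    totalMap F F' Φ (Q.act g u) = Q'.act g (totalMap F F' Φ u)

end Mono

/-! ### Smooth complex vector bundles -/

/-- A complex vector bundle is a real vector bundle. -/
theorem vectorBundle_real_of_complex {J : Type*} [TopologicalSpace J]
    (F : Type*) [NormedAddCommGroup F] [NormedSpace ℂ F]
    (E : J → Type*) [∀ x, AddCommGroup (E x)] [∀ x, Module ℂ (E x)]
    [TopologicalSpace (TotalSpace F E)] [∀ x, TopologicalSpace (E x)]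
    [FiberBundle F E] [VectorBundle ℂ F E] : VectorBundle ℝ F E := by
  have hlin : ∀ (e : Trivialization F (π F E)) [MemTrivializationAtlas e], e.IsLinear ℝ := by
    intro e _
    refine ⟨fun b hb => ?_⟩
    have h := e.linear ℂ hb
    exact ⟨h.map_add, fun c v => by
      have := h.map_smul (c : ℂ) v
      simpa only [Complex.coe_smul] using this⟩
  refine ⟨hlin, fun e e' he he' => ?_⟩
  have := hlin e
  have := hlin e'
  have hc := continuousOn_coordChange ℂ e e'
  have hr : Continuous (ContinuousLinearMap.restrictScalarsL ℂ F F ℝ ℝ) :=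
    (ContinuousLinearMap.restrictScalarsL ℂ F F ℝ ℝ).continuous
  refine (hr.comp_continuousOn hc).congr fun b hb => ?_
  ext v
  change Trivialization.coordChangeL ℝ e e' b v = Trivialization.coordChangeL ℂ e e' b v
  rw [Trivialization.coordChangeL_apply' e e' hb, Trivialization.coordChangeL_apply' e e' hb]

/-- A complex vector bundle over a smooth `k`-manifold is smooth if its transition functions are
smooth. -/
def IsSmoothComplexBundle (k : ℕ) {J : Type*} [TopologicalSpace J]
    [ChartedSpace (EuclideanSpace ℝ (Fin k)) J]
    (F : Type*) [NormedAddCommGroup F] [NormedSpace ℂ F]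
    (E : J → Type*) [∀ x, AddCommGroup (E x)] [∀ x, Module ℂ (E x)]
    [TopologicalSpace (TotalSpace F E)] [∀ x, TopologicalSpace (E x)]
    [FiberBundle F E] [VectorBundle ℂ F E] : Prop :=
  haveI : VectorBundle ℝ F E := vectorBundle_real_of_complex F E
  ContMDiffVectorBundle ∞ F E (𝓡 k)

/-! Conjugation by `ι` is an involution `Q.conj` on homomorphisms `E → J × ℍ^m`, and its fixed
points are the equivariant homomorphisms. Any homomorphism can be symmetrised by adding its
conjugate, so the task is to find a fixed point of `Q.conj` that is injective on every fibre.

Over a fixed point of `ιJ` the fibre is a quaternionic vector space of dimension `l ≤ m`, so it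
embeds in `ℍ^m` (`exists_quaternionic_embedding`). There are finitely many fixed points; cutting
off, summing and symmetrising gives an equivariant homomorphism injective over them, hence over a
neighbourhood of them.

Near any other point, a small open set is disjoint from its image under `ιJ`. There the homomorphism
may be perturbed without constraint, the conjugate perturbation being made over the image.
Non-injective maps `ℂ^{2l} → ℂ^{2m}` have real codimension `4(m - l) + 2`, which exceeds `k` for the
given `m`, so a generic small translate of a `C¹` family avoids them
(`dense_setOf_forall_injective_add`). Injectivity is an open condition, so small perturbations
preserve it on a closed set where it already holds, and compactness of `J` reduces everything to
finitely many perturbations.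

The argument is run in class `C^n` for any `n ≤ ∞`: `n = 0` gives the continuous statement and `n =
∞` the smooth one. -/

/-! ### Quaternionic vector spaces -/

section QuaternionicVectorSpace

/-- The anti-automorphism of the quaternions that fixes `ℂ` and `𝐣`. -/
def Quaternion.reverse (q : ℍ[ℝ]) : ℍ[ℝ] := ⟨q.re, q.imI, q.imJ, -q.imK⟩

namespace Quaternion

@[simp] theorem re_reverse (q : ℍ[ℝ]) : q.reverse.re = q.re := rfl
@[simp] theorem imI_reverse (q : ℍ[ℝ]) : q.reverse.imI = q.imI := rfl
@[simp] theorem imJ_reverse (q : ℍ[ℝ]) : q.reverse.imJ = q.imJ := rfl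
@[simp] theorem imK_reverse (q : ℍ[ℝ]) : q.reverse.imK = -q.imK := rfl

theorem reverse_injective : Injective Quaternion.reverse := by
  have h : LeftInverse Quaternion.reverse Quaternion.reverse := fun q => by ext <;> simp
  exact h.injective

theorem reverse_add (p q : ℍ[ℝ]) : (p + q).reverse = p.reverse + q.reverse := by
  ext <;> simp
  ring

theorem reverse_mul (p q : ℍ[ℝ]) : (p * q).reverse = q.reverse * p.reverse := by
  ext <;> simp <;> ring

end Quaternion

variable {V : Type*} [AddCommGroup V] [Module ℂ V]

/-- A conjugate-linear map with square `-1` extends the complex structure to an `ℍ`-module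
structure, in which `𝐣` acts by the given map. -/
@[reducible] noncomputable def quaternionModule (j : V →ₛₗ[starRingEnd ℂ] V)
    (hj : ∀ v, j (j v) = -v) : Module ℍ[ℝ] V where
  -- Write `q = z + w𝐣` with `z, w ∈ ℂ`; the product formulas below then come from `𝐣z = z̄𝐣`.
  smul q v := (⟨q.re, q.imI⟩ : ℂ) • v + (⟨q.imJ, q.imK⟩ : ℂ) • j v
  one_smul v := by
    change (⟨(1 : ℍ[ℝ]).re, (1 : ℍ[ℝ]).imI⟩ : ℂ) • v
      + (⟨(1 : ℍ[ℝ]).imJ, (1 : ℍ[ℝ]).imK⟩ : ℂ) • j v = v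
    have h1 : (⟨(1 : ℍ[ℝ]).re, (1 : ℍ[ℝ]).imI⟩ : ℂ) = 1 := by apply Complex.ext <;> simp
    have h2 : (⟨(1 : ℍ[ℝ]).imJ, (1 : ℍ[ℝ]).imK⟩ : ℂ) = 0 := by apply Complex.ext <;> simp
    rw [h1, h2, one_smul, zero_smul, add_zero]
  mul_smul p q v := by
    change (⟨(p * q).re, (p * q).imI⟩ : ℂ) • v + (⟨(p * q).imJ, (p * q).imK⟩ : ℂ) • j v
      = (⟨p.re, p.imI⟩ : ℂ) • ((⟨q.re, q.imI⟩ : ℂ) • v + (⟨q.imJ, q.imK⟩ : ℂ) • j v)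
      + (⟨p.imJ, p.imK⟩ : ℂ) • j ((⟨q.re, q.imI⟩ : ℂ) • v + (⟨q.imJ, q.imK⟩ : ℂ) • j v)
    have h1 : (⟨(p * q).re, (p * q).imI⟩ : ℂ) = (⟨p.re, p.imI⟩ : ℂ) * ⟨q.re, q.imI⟩
        - (⟨p.imJ, p.imK⟩ : ℂ) * starRingEnd ℂ ⟨q.imJ, q.imK⟩ := by
      apply Complex.ext <;> simp <;> ring
    have h2 : (⟨(p * q).imJ, (p * q).imK⟩ : ℂ) = (⟨p.re, p.imI⟩ : ℂ) * ⟨q.imJ, q.imK⟩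
        + (⟨p.imJ, p.imK⟩ : ℂ) * starRingEnd ℂ ⟨q.re, q.imI⟩ := by
      apply Complex.ext <;> simp <;> ring
    rw [h1, h2, map_add, map_smulₛₗ, map_smulₛₗ, hj]
    module
  smul_zero q := by
    change (_ : ℂ) • (0 : V) + (_ : ℂ) • j 0 = 0
    simp
  smul_add q v w := by
    change (_ : ℂ) • (v + w) + (_ : ℂ) • j (v + w)
      = ((_ : ℂ) • v + (_ : ℂ) • j v) + ((_ : ℂ) • w + (_ : ℂ) • j w)
    rw [map_add]; module
  add_smul p q v := by
    change (⟨(p + q).re, (p + q).imI⟩ : ℂ) • v + (⟨(p + q).imJ, (p + q).imK⟩ : ℂ) • j v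
      = ((⟨p.re, p.imI⟩ : ℂ) • v + (⟨p.imJ, p.imK⟩ : ℂ) • j v)
      + ((⟨q.re, q.imI⟩ : ℂ) • v + (⟨q.imJ, q.imK⟩ : ℂ) • j v)
    have h1 : (⟨(p + q).re, (p + q).imI⟩ : ℂ) = ⟨p.re, p.imI⟩ + ⟨q.re, q.imI⟩ := by
      apply Complex.ext <;> simp
    have h2 : (⟨(p + q).imJ, (p + q).imK⟩ : ℂ) = ⟨p.imJ, p.imK⟩ + ⟨q.imJ, q.imK⟩ := by
      apply Complex.ext <;> simp
    rw [h1, h2]; module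
  zero_smul v := by
    change (⟨(0 : ℍ[ℝ]).re, (0 : ℍ[ℝ]).imI⟩ : ℂ) • v
      + (⟨(0 : ℍ[ℝ]).imJ, (0 : ℍ[ℝ]).imK⟩ : ℂ) • j v = 0
    have h1 : (⟨(0 : ℍ[ℝ]).re, (0 : ℍ[ℝ]).imI⟩ : ℂ) = 0 := by apply Complex.ext <;> simp
    have h2 : (⟨(0 : ℍ[ℝ]).imJ, (0 : ℍ[ℝ]).imK⟩ : ℂ) = 0 := by apply Complex.ext <;> simp
    rw [h1, h2, zero_smul, zero_smul, add_zero]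

/-- Choose an `ℍ`-basis of `V`. Its coordinates are linear for left multiplication, while `QuatSpace
m` uses right multiplication; `Quaternion.reverse` exchanges the two and leaves `ℂ` and `𝐣`
unchanged. -/
theorem exists_quaternionic_embedding [FiniteDimensional ℂ V] (j : V →ₛₗ[starRingEnd ℂ] V)
    (hj : ∀ v, j (j v) = -v) {l m : ℕ} (hV : Module.finrank ℂ V = 2 * l) (hlm : l ≤ m) :
    ∃ A : V →ₗ[ℂ] QuatSpace m, Injective A ∧ ∀ v, A (j v) = QuatSpace.mulJ m (A v) := by
  let _ := quaternionModule j hj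
  have smul_def (q : ℍ[ℝ]) (v : V) :
      q • v = (⟨q.re, q.imI⟩ : ℂ) • v + (⟨q.imJ, q.imK⟩ : ℂ) • j v := rfl
  have smul_coe (z : ℂ) (v : V) : z • v = (z : ℍ[ℝ]) • v := by
    have h2 : (⟨(z : ℍ[ℝ]).imJ, (z : ℍ[ℝ]).imK⟩ : ℂ) = 0 := by apply Complex.ext <;> simp
    have h1 : (⟨(z : ℍ[ℝ]).re, (z : ℍ[ℝ]).imI⟩ : ℂ) = z := by apply Complex.ext <;> simp
    rw [smul_def, h1, h2, zero_smul, add_zero]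
  have smul_jj (v : V) : j v = QuatSpace.jj • v := by
    have h2 : (⟨QuatSpace.jj.imJ, QuatSpace.jj.imK⟩ : ℂ) = 1 := by
      apply Complex.ext <;> simp [QuatSpace.jj]
    have h1 : (⟨QuatSpace.jj.re, QuatSpace.jj.imI⟩ : ℂ) = 0 := by
      apply Complex.ext <;> simp [QuatSpace.jj]
    rw [smul_def, h1, h2, zero_smul, one_smul, zero_add]
  have : IsScalarTower ℝ ℍ[ℝ] V := by
    refine IsScalarTower.of_algebraMap_smul fun r v => ?_
    change ((r : ℝ) : ℍ[ℝ]) • v = ((r : ℂ)) • v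
    rw [smul_coe]; congr 1
  have : Module.Finite ℝ V := FiniteDimensional.complexToReal V
  have : Module.Finite ℍ[ℝ] V := Module.Finite.of_restrictScalars_finite ℝ ℍ[ℝ] V
  have hn : Module.finrank ℍ[ℝ] V = l := by
    have h1 := Module.finrank_mul_finrank ℝ ℍ[ℝ] V
    rw [Quaternion.finrank_eq_four, finrank_real_of_complex, hV] at h1
    omega
  let b : Module.Basis (Fin l) ℍ[ℝ] V := Module.finBasisOfFinrankEq _ _ hn
  -- The `l` coordinates are padded with zeros up to length `m`.
  let f : V → QuatSpace m := fun v i =>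
    if h : (i : ℕ) < l then (b.repr v ⟨i, h⟩).reverse else 0
  have f_smul (q : ℍ[ℝ]) (v : V) (i : Fin m) : f (q • v) i = f v i * q.reverse := by
    by_cases h : (i : ℕ) < l
    · simp [f, h, Quaternion.reverse_mul]
    · simp [f, h]
  refine ⟨{ toFun := f, map_add' := fun v w => ?_, map_smul' := fun z v => ?_ }, ?_, ?_⟩
  · funext i
    change f (v + w) i = f v i + f w i
    by_cases h : (i : ℕ) < l
    · simp [f, h, Quaternion.reverse_add]
    · simp [f, h]
  · funext i
    rw [smul_coe, f_smul, RingHom.id_apply, QuatSpace.smul_apply]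
    congr 1
    ext <;> simp [Quaternion.reverse]
  · intro v w h
    apply b.repr.injective
    ext1 i
    have hi : f v ⟨i, i.2.trans_le hlm⟩ = f w ⟨i, i.2.trans_le hlm⟩ :=
      congrFun h _
    simp only [f, i.2, dite_true] at hi
    exact Quaternion.reverse_injective hi
  · intro v
    funext i
    change f (j v) i = f v i * QuatSpace.jj
    rw [smul_jj, f_smul]
    congr 1
    ext <;> simp [Quaternion.reverse, QuatSpace.jj]

end QuaternionicVectorSpace

/-! ### Dimension of `ℍ^m` -/

namespace QuatSpace

/-- The identity, as a real linear equivalence with the space of `m`-tuples of quaternions. -/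
noncomputable def realEquiv (m : ℕ) : QuatSpace m ≃ₗ[ℝ] (Fin m → ℍ[ℝ]) where
  toFun q := q
  invFun q := q
  left_inv _ := rfl
  right_inv _ := rfl
  map_add' _ _ := rfl
  map_smul' r q := funext fun i => by
    change q i * (((r : ℂ) : ℍ[ℝ])) = r • q i
    have : ((r : ℂ) : ℍ[ℝ]) = (r : ℍ[ℝ]) := by ext <;> simp
    rw [this, Quaternion.mul_coe_eq_smul]

instance (m : ℕ) : FiniteDimensional ℝ (QuatSpace m) :=
  Module.Finite.equiv (realEquiv m).symm

instance (m : ℕ) : FiniteDimensional ℂ (QuatSpace m) :=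
  Module.Finite.of_restrictScalars_finite ℝ ℂ (QuatSpace m)

theorem finrank_complex (m : ℕ) : Module.finrank ℂ (QuatSpace m) = 2 * m := by
  have h := (realEquiv m).finrank_eq
  rw [finrank_real_of_complex, Module.finrank_pi_fintype] at h
  simp only [Quaternion.finrank_eq_four, Finset.sum_const, Finset.card_univ, Fintype.card_fin,
    smul_eq_mul] at h
  omega

end QuatSpace

/-! ### General position for families of linear maps -/

section GeneralPosition

open Module

variable {F G : Type*} [NormedAddCommGroup F] [NormedSpace ℂ F] [FiniteDimensional ℂ F]
  [NormedAddCommGroup G] [NormedSpace ℂ G] [FiniteDimensional ℂ G]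
  {X : Type*} [NormedAddCommGroup X] [NormedSpace ℝ X] [FiniteDimensional ℝ X]

theorem finrank_real_continuousLinearMap :
    finrank ℝ (F →L[ℂ] G) = 2 * (finrank ℂ F * finrank ℂ G) := by
  rw [finrank_real_of_complex,
    ← (LinearMap.toContinuousLinearMap : (F →ₗ[ℂ] G) ≃ₗ[ℂ] (F →L[ℂ] G)).finrank_eq,
    Module.finrank_linearMap]

/-- If `X` has smaller dimension than the codimension of the set of non-injective maps `F → G`,
then almost all translates of a `C¹` family of linear maps parametrised by a convex subset of `X`
consist of injective maps. -/
theorem dense_setOf_forall_injective_add {g : X → F →L[ℂ] G} {s : Set X} (hs : Convex ℝ s)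
    (hg : ContDiffOn ℝ 1 g s)
    (hdim : finrank ℝ X + 2 * finrank ℂ F < 2 * finrank ℂ G + 2) :
    Dense {A : F →L[ℂ] G | ∀ x ∈ s, Injective (g x + A)} := by
  have : FiniteDimensional ℝ F := FiniteDimensional.complexToReal F
  have : FiniteDimensional ℝ G := FiniteDimensional.complexToReal G
  have : FiniteDimensional ℂ (F →L[ℂ] G) :=
    Module.Finite.equiv (LinearMap.toContinuousLinearMap : (F →ₗ[ℂ] G) ≃ₗ[ℂ] (F →L[ℂ] G))
  have : FiniteDimensional ℝ (F →L[ℂ] G) := FiniteDimensional.complexToReal _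
  -- The parametrisation below singles out one basis vector, so `F = 0` is treated apart.
  rcases Nat.eq_zero_or_pos (finrank ℂ F) with h0 | hpos
  · have : Subsingleton F := finrank_zero_iff.1 h0
    convert dense_univ
    exact Set.eq_univ_of_forall fun A x _ => injective_of_subsingleton _
  obtain ⟨a, ha⟩ := Nat.exists_eq_add_of_lt hpos
  rw [zero_add] at ha
  let b : Basis (Fin (a + 1)) ℂ F := finBasisOfFinrankEq _ _ ha
  let Λ : (Fin (a + 1) → G) →ₗ[ℝ] (F →L[ℂ] G) :=
    ((LinearMap.toContinuousLinearMap : (F →ₗ[ℂ] G) ≃ₗ[ℂ] (F →L[ℂ] G)).toLinearMap ∘ₗ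
      (b.constr ℂ (M' := G)).toLinearMap).restrictScalars ℝ
  have hΛ (w) (i) : Λ w (b i) = w i := by
    change b.constr ℂ w (b i) = w i
    exact b.constr_basis ℂ w i
  -- A linear map is non-injective exactly when some column `i` is a combination of the other `a`.
  -- These maps are thus parametrised by `a` coefficients and `a` vectors of `G`.
  let w (i : Fin (a + 1)) (p : (Fin a → ℂ) × (Fin a → G)) : Fin (a + 1) → G :=
    i.insertNth (-∑ j, p.1 j • p.2 j) p.2
  have hw (i) : ContDiff ℝ 1 (w i) := by
    refine contDiff_pi.2 ((Fin.forall_iff_succAbove i).2 ⟨?_, fun j => ?_⟩)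
    · simp only [w, Fin.insertNth_apply_same]
      fun_prop
    · simp only [w, Fin.insertNth_apply_succAbove]
      fun_prop
  -- The bad translates `A`, those with `g x + A` non-injective for some `x ∈ s`, all lie in the
  -- images of the `P i`.
  let P (i : Fin (a + 1)) (y : X × ((Fin a → ℂ) × (Fin a → G))) : F →L[ℂ] G :=
    Λ (w i y.2) - g y.1
  have hP (i) : ContDiffOn ℝ 1 (P i) (s ×ˢ Set.univ) := by
    refine ContDiffOn.sub ?_ (hg.comp contDiffOn_fst fun y hy => hy.1)
    exact ((LinearMap.toContinuousLinearMap Λ).contDiff.comp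
      ((hw i).comp contDiff_snd)).contDiffOn
  have hdimP (i) : dimH (P i '' (s ×ˢ Set.univ)) <
      (finrank ℝ (F →L[ℂ] G) : ENNReal) := by
    -- A `C¹` map on a convex set does not raise Hausdorff dimension, so it suffices to compare `dim
    -- X + 2a + 2a · dim G` with `2(a + 1) · dim G` (`G` over `ℂ`, `X` over `ℝ`); this is `hdim`.
    refine ((hP i).dimH_image_le (hs.prod convex_univ) subset_rfl).trans_lt ?_
    refine (dimH_mono (Set.subset_univ _)).trans_lt ?_
    rw [Real.dimH_univ_eq_finrank, Nat.cast_lt, finrank_real_continuousLinearMap,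
      finrank_prod, finrank_prod, Module.finrank_pi_fintype, Module.finrank_pi_fintype]
    simp only [Complex.finrank_real_complex, finrank_real_of_complex G, Finset.sum_const,
      Finset.card_univ, Fintype.card_fin, smul_eq_mul]
    rw [ha] at hdim ⊢
    nlinarith
  have hU : dimH (⋃ i, P i '' (s ×ˢ Set.univ)) < (finrank ℝ (F →L[ℂ] G) : ENNReal) := by
    rw [dimH_iUnion]
    obtain ⟨i, hi⟩ := exists_eq_ciSup_of_finite (f := fun i => dimH (P i '' (s ×ˢ Set.univ)))
    rw [← hi]
    exact hdimP i
  refine (dense_compl_of_dimH_lt_finrank hU).mono fun A hA x hx => ?_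
  by_contra hinj
  apply hA
  rw [injective_iff_map_eq_zero] at hinj
  push Not at hinj
  obtain ⟨v, hv, hv0⟩ := hinj
  obtain ⟨i, hi⟩ : ∃ i, b.repr v i ≠ 0 := by
    by_contra! h
    exact hv0 (b.repr.map_eq_zero_iff.1 (Finsupp.ext h))
  set N := g x + A with hN
  have hsum : ∑ j, b.repr v j • N (b j) = 0 := by
    rw [← hv]
    conv_rhs => rw [← b.sum_repr v, map_sum]
    simp only [map_smul]
  -- The relation among the columns of `N`, divided by its nonzero `i`-th coefficient, expresses
  -- column `i` through the others.
  refine Set.mem_iUnion.2 ⟨i, (x, fun j => (b.repr v i)⁻¹ * b.repr v (i.succAbove j),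
    fun j => N (b (i.succAbove j))), ⟨hx, trivial⟩, ?_⟩
  have hΛN : Λ (w i (fun j => (b.repr v i)⁻¹ * b.repr v (i.succAbove j),
      fun j => N (b (i.succAbove j)))) = N := by
    refine ContinuousLinearMap.coe_injective (b.ext ((Fin.forall_iff_succAbove i).2
      ⟨?_, fun j => ?_⟩))
    · rw [ContinuousLinearMap.coe_coe, ContinuousLinearMap.coe_coe, hΛ]
      simp only [w, Fin.insertNth_apply_same]
      rw [Fin.sum_univ_succAbove _ i] at hsum
      simp only [mul_smul, ← Finset.smul_sum]
      rw [← eq_neg_of_add_eq_zero_right hsum |>.symm, smul_neg, neg_neg, inv_smul_smul₀ hi]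
    · rw [ContinuousLinearMap.coe_coe, ContinuousLinearMap.coe_coe, hΛ]
      simp only [w, Fin.insertNth_apply_succAbove]
  change Λ _ - g x = A
  rw [hΛN, hN, add_sub_cancel_left]

end GeneralPosition

/-! ### Conjugation of homomorphisms into the trivial bundle -/

section Conj

variable {J : Type*} {ιJ : J → J} {F : Type*} {E : J → Type*} [∀ x, AddCommGroup (E x)]
  [∀ x, Module ℂ (E x)] [TopologicalSpace (TotalSpace F E)] {m : ℕ}

/-- The conjugate of a homomorphism `E → J × ℍ^m` by the action of `ι`. -/
noncomputable def QuaternionicStructure.conj (Q : QuaternionicStructure ιJ F E)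
    (Φ : ∀ x, E x →ₗ[ℂ] QuatSpace m) (x : J) : E x →ₗ[ℂ] QuatSpace m where
  -- The sign appears because the inverse of `mulJ` is `-mulJ`.
  toFun v := -QuatSpace.mulJ m (Φ (ιJ x) (Q.fiberMap x v))
  map_add' v w := by simp only [map_add, neg_add]
  map_smul' z v := by
    simp only [map_smulₛₗ, Complex.conj_conj, smul_neg, RingHom.id_apply]

namespace QuaternionicStructure

variable (Q : QuaternionicStructure ιJ F E)

theorem conj_apply (Φ : ∀ x, E x →ₗ[ℂ] QuatSpace m) (x : J) (v : E x) :
    Q.conj Φ x v = -QuatSpace.mulJ m (Φ (ιJ x) (Q.fiberMap x v)) := rfl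

theorem conj_add (Φ Ψ : ∀ x, E x →ₗ[ℂ] QuatSpace m) :
    Q.conj (Φ + Ψ) = Q.conj Φ + Q.conj Ψ := by
  funext x
  ext1 v
  simp only [conj_apply, Pi.add_apply, LinearMap.add_apply, map_add, neg_add]

theorem conj_conj (Φ : ∀ x, E x →ₗ[ℂ] QuatSpace m) : Q.conj (Q.conj Φ) = Φ := by
  funext x
  ext1 v
  have h := congrArg (fun u : TotalSpace F E => Φ u.proj u.2) (Q.sq_eq_neg x v)
  simp only [map_neg] at h
  rw [conj_apply, conj_apply, map_neg, neg_neg, QuatSpace.mulJ_mulJ, h, neg_neg]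

theorem fiberMap_injective (x : J) : Injective (Q.fiberMap x) := by
  refine (injective_iff_map_eq_zero _).2 fun v hv => ?_
  have h := Q.sq_eq_neg x v
  rw [hv, map_zero] at h
  -- The vectors in `h` lie over `ιJ (ιJ x)` and `x`; the zero vector is used to bring both sides
  -- into the same fibre.
  have h' : (⟨ιJ (ιJ x), 0⟩ : TotalSpace F E) = ⟨x, 0⟩ := by
    have := Q.sq_eq_neg x 0
    rwa [map_zero, map_zero, neg_zero] at this
  rw [h'] at h
  exact (neg_eq_zero.1 (TotalSpace.mk_injective x h).symm)

variable {Q} {Φ : ∀ x, E x →ₗ[ℂ] QuatSpace m}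

theorem apply_fiberMap (h : Q.conj Φ = Φ) (x : J) (v : E x) :
    Φ (ιJ x) (Q.fiberMap x v) = QuatSpace.mulJ m (Φ x v) := by
  conv_rhs => rw [← h]
  rw [conj_apply, map_neg, QuatSpace.mulJ_mulJ, neg_neg]

theorem injective_of_injective_apply (h : Q.conj Φ = Φ) {x : J} (hx : Injective (Φ (ιJ x))) :
    Injective (Φ x) := by
  refine (injective_iff_map_eq_zero _).2 fun v hv => ?_
  apply Q.fiberMap_injective x
  apply hx
  rw [apply_fiberMap h, hv, map_zero, map_zero, map_zero]

theorem injective_apply_iff (hinv : Involutive ιJ) (h : Q.conj Φ = Φ) {x : J} :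
    Injective (Φ (ιJ x)) ↔ Injective (Φ x) := by
  refine ⟨injective_of_injective_apply h, fun hx => injective_of_injective_apply h ?_⟩
  rwa [hinv x]

/-- The value of `Q.conj Φ` at `x` depends only on `Φ` at `ιJ x`. Hence a perturbation supported
away from its mirror image does not interact with its conjugate. -/
theorem conj_eq_zero {x : J} (h : Φ (ιJ x) = 0) : Q.conj Φ x = 0 := by
  ext1 v
  rw [conj_apply, h, LinearMap.zero_apply, map_zero, neg_zero, LinearMap.zero_apply]

end QuaternionicStructure

end Conj

/-! ### Homomorphisms in local coordinates -/

section LocalRep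

variable {J : Type*} [TopologicalSpace J] {F : Type*} [NormedAddCommGroup F] [NormedSpace ℂ F]
  {E : J → Type*} [∀ x, AddCommGroup (E x)] [∀ x, Module ℂ (E x)]
  [TopologicalSpace (TotalSpace F E)] {m : ℕ} (e : Trivialization F (π F E))
  [e.IsLinear ℂ]

/-- A homomorphism in the coordinates of a trivialization. -/
noncomputable def localRep [FiniteDimensional ℂ F] (Φ : ∀ x, E x →ₗ[ℂ] QuatSpace m) (x : J) :
    F →L[ℂ] QuatSpace m :=
  LinearMap.toContinuousLinearMap (Φ x ∘ₗ e.symmₗ ℂ x)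

variable {e} [FiniteDimensional ℂ F]

theorem localRep_apply (Φ : ∀ x, E x →ₗ[ℂ] QuatSpace m) (x : J) (v : F) :
    localRep e Φ x v = Φ x (e.symmₗ ℂ x v) := rfl

theorem continuousOn_localRep {Φ : ∀ x, E x →ₗ[ℂ] QuatSpace m}
    (hΦ : Continuous (fun u : TotalSpace F E => Φ u.proj u.2)) :
    ContinuousOn (localRep e Φ) e.baseSet := by
  -- Since `F` is finite-dimensional, norm continuity can be tested on each vector.
  refine continuousOn_clm_apply.2 fun v => ?_
  have h : ContinuousOn (fun x => e.toOpenPartialHomeomorph.symm (x, v)) e.baseSet :=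
    e.toOpenPartialHomeomorph.continuousOn_symm.comp
      (Continuous.continuousOn (by fun_prop)) fun x hx => e.mem_target.2 hx
  refine (hΦ.comp_continuousOn h).congr fun x hx => ?_
  rw [comp_apply, ← e.mk_symm hx, localRep_apply, e.coe_symmₗ hx]

theorem injective_localRep_iff {Φ : ∀ x, E x →ₗ[ℂ] QuatSpace m} {x : J} (hx : x ∈ e.baseSet) :
    Injective (localRep e Φ x) ↔ Injective (Φ x) := by
  have hb : Bijective (e.symmₗ ℂ x) := bijective_iff_has_inverse.2
    ⟨e.linearMapAt ℂ x, e.linearMapAt_symmₗ hx, e.symmₗ_linearMapAt hx⟩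
  exact Injective.of_comp_iff' (Φ x) hb

end LocalRep

/-! ### Homomorphisms of class `C^n` -/

section ContMDiffHom

open scoped Topology

variable (k : ℕ) {J : Type*} [TopologicalSpace J] [ChartedSpace (EuclideanSpace ℝ (Fin k)) J]
  {ιJ : J → J} (F : Type*) [NormedAddCommGroup F] [NormedSpace ℂ F]
  {E : J → Type*} [∀ x, AddCommGroup (E x)] [∀ x, Module ℂ (E x)]
  [TopologicalSpace (TotalSpace F E)] [∀ x, TopologicalSpace (E x)] [FiberBundle F E]
  {m : ℕ} (n : WithTop ℕ∞)

/-- A homomorphism from `E` to the trivial bundle with fibre `ℍ^m` is of class `C^n`. -/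
def IsContMDiffHom (Φ : ∀ x, E x →ₗ[ℂ] QuatSpace m) : Prop :=
  ContMDiff ((𝓡 k).prod 𝓘(ℝ, F)) 𝓘(ℝ, QuatSpace m) n
    (fun u : TotalSpace F E => Φ u.proj u.2)

variable {k F n}

namespace IsContMDiffHom

variable {Φ Ψ : ∀ x, E x →ₗ[ℂ] QuatSpace m}

theorem add (hΦ : IsContMDiffHom k F n Φ) (hΨ : IsContMDiffHom k F n Ψ) :
    IsContMDiffHom k F n (Φ + Ψ) :=
  ContMDiff.add hΦ hΨ

theorem sub (hΦ : IsContMDiffHom k F n Φ) (hΨ : IsContMDiffHom k F n Ψ) :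
    IsContMDiffHom k F n (Φ - Ψ) :=
  ContMDiff.sub hΦ hΨ

theorem smul {φ : J → ℝ} (hφ : ContMDiff (𝓡 k) 𝓘(ℝ, ℝ) n φ) (hΦ : IsContMDiffHom k F n Φ) :
    IsContMDiffHom k F n (fun x => φ x • Φ x) :=
  ContMDiff.smul (hφ.comp (contMDiff_proj E)) hΦ

theorem sum {ι : Type*} {t : Finset ι} {Φ : ι → ∀ x, E x →ₗ[ℂ] QuatSpace m}
    (hΦ : ∀ i ∈ t, IsContMDiffHom k F n (Φ i)) :
    IsContMDiffHom k F n (fun x => ∑ i ∈ t, Φ i x) := by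
  have h := contMDiff_finsetSum hΦ
  simpa only [IsContMDiffHom, LinearMap.sum_apply] using h

theorem conj {Q : QuaternionicStructure ιJ F E}
    (hQ : ContMDiff ((𝓡 k).prod 𝓘(ℝ, F)) ((𝓡 k).prod 𝓘(ℝ, F)) n Q.total)
    (hΦ : IsContMDiffHom k F n Φ) : IsContMDiffHom k F n (Q.conj Φ) := by
  let R : QuatSpace m →ₗ[ℝ] QuatSpace m :=
    { toFun := QuatSpace.mulJ m
      map_add' := map_add _
      map_smul' := fun r q => by
        rw [← Complex.coe_smul, map_smulₛₗ, Complex.conj_ofReal, Complex.coe_smul]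
        rfl }
  have h : ContMDiff 𝓘(ℝ, QuatSpace m) 𝓘(ℝ, QuatSpace m) n R :=
    (LinearMap.toContinuousLinearMap R).contDiff.contMDiff
  exact ContMDiff.neg (h.comp (ContMDiff.comp hΦ hQ))

theorem continuous_apply (hΦ : IsContMDiffHom k F n Φ) :
    Continuous (fun u : TotalSpace F E => Φ u.proj u.2) :=
  ContMDiff.continuous hΦ

end IsContMDiffHom

theorem contMDiff_totalMap_iff {Φ : ∀ x, E x →ₗ[ℂ] Bundle.Trivial J (QuatSpace m) x} :
    ContMDiff ((𝓡 k).prod 𝓘(ℝ, F)) ((𝓡 k).prod 𝓘(ℝ, QuatSpace m)) n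
      (totalMap F (QuatSpace m) Φ) ↔
    IsContMDiffHom k F n (fun x => (Φ x : E x →ₗ[ℂ] QuatSpace m)) := by
  constructor
  · intro h u
    exact (contMDiffAt_totalSpace.1 (h u)).2
  · intro h u
    exact contMDiffAt_totalSpace.2 ⟨contMDiff_proj E u, h u⟩

variable [VectorBundle ℂ F E]

theorem isOpen_setOf_injective [FiniteDimensional ℂ F] {Φ : ∀ x, E x →ₗ[ℂ] QuatSpace m}
    (hΦ : Continuous (fun u : TotalSpace F E => Φ u.proj u.2)) :
    IsOpen {x | Injective (Φ x)} := by
  refine isOpen_iff_mem_nhds.2 fun x hx => ?_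
  let e := trivializationAt F E x
  have hxe : x ∈ e.baseSet := mem_baseSet_trivializationAt F E x
  have hc : ContinuousAt (localRep e Φ) x :=
    (continuousOn_localRep hΦ).continuousAt (e.open_baseSet.mem_nhds hxe)
  have hO := hc.eventually (ContinuousLinearMap.isOpen_injective.mem_nhds
    ((injective_localRep_iff hxe).2 hx))
  filter_upwards [hO, e.open_baseSet.mem_nhds hxe] with y hy hye
  exact (injective_localRep_iff hye).1 hy

/-- The local formula is `C^n` over `e.baseSet`, and the cutoff makes it vanish near every point
outside. Differentiability of `e` is a real notion, so `g` is restricted to real scalars. -/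
theorem isContMDiffHom_smul_comp_linearMapAt [VectorBundle ℝ F E]
    [ContMDiffVectorBundle n F E (𝓡 k)]
    (e : Trivialization F (π F E)) [MemTrivializationAtlas e]
    {φ : J → ℝ} (hφ : ContMDiff (𝓡 k) 𝓘(ℝ, ℝ) n φ) (hφe : tsupport φ ⊆ e.baseSet)
    {g : J → F →L[ℂ] QuatSpace m} (hg : ContMDiff (𝓡 k) 𝓘(ℝ, F →L[ℂ] QuatSpace m) n g) :
    IsContMDiffHom k F n (fun x => φ x • ((g x).toLinearMap ∘ₗ e.linearMapAt ℂ x)) := by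
  intro u
  by_cases hu : u.proj ∈ e.baseSet
  · have he : ContMDiffAt ((𝓡 k).prod 𝓘(ℝ, F)) 𝓘(ℝ, F) n
        (fun u : TotalSpace F E => (e u).2) u :=
      ContMDiffAt.snd ((e.contMDiffOn (IB := 𝓡 k) (n := n) (𝕜 := ℝ)).contMDiffAt
        (e.open_source.mem_nhds (e.mem_source.2 hu)))
    have hgr : ContMDiff (𝓡 k) 𝓘(ℝ, F →L[ℝ] QuatSpace m) n
        (fun x => (g x).restrictScalars ℝ) :=
      (ContinuousLinearMap.restrictScalarsL ℂ F (QuatSpace m) ℝ ℝ).contDiff.contMDiff.comp hg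
    have h := ((hφ.comp (contMDiff_proj E)).contMDiffAt (x := u)).smul
      (((hgr.comp (contMDiff_proj E)).contMDiffAt (x := u)).clm_apply he)
    refine h.congr_of_eventuallyEq ?_
    filter_upwards [e.open_source.mem_nhds (e.mem_source.2 hu)] with w hw
    change φ w.proj • g w.proj (e.linearMapAt ℂ w.proj w.2) = φ w.proj • g w.proj (e w).2
    rw [e.coe_linearMapAt_of_mem (e.mem_source.1 hw)]
  · refine contMDiffAt_const (c := (0 : QuatSpace m)) |>.congr_of_eventuallyEq ?_
    have hO : IsOpen ((π F E) ⁻¹' (tsupport φ)ᶜ) :=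
      (isClosed_tsupport φ).isOpen_compl.preimage (FiberBundle.continuous_proj F E)
    filter_upwards [hO.mem_nhds (fun h => hu (hφe h))] with w hw
    change φ w.proj • g w.proj (e.linearMapAt ℂ w.proj w.2) = 0
    rw [image_eq_zero_of_notMem_tsupport hw, zero_smul]

end ContMDiffHom

/-! ### Fibres over fixed points -/

section Fiber

variable {J : Type*} [TopologicalSpace J]
  {F : Type*} [NormedAddCommGroup F] [NormedSpace ℂ F]
  {E : J → Type*} [∀ x, AddCommGroup (E x)] [∀ x, Module ℂ (E x)]
  [TopologicalSpace (TotalSpace F E)] [∀ x, TopologicalSpace (E x)] [FiberBundle F E]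
  [VectorBundle ℂ F E] {ιJ : J → J} {Q : QuaternionicStructure ιJ F E} {m : ℕ}

theorem finrank_fiber (x : J) : Module.finrank ℂ (E x) = Module.finrank ℂ F :=
  ((trivializationAt F E x).linearEquivAt ℂ x (mem_baseSet_trivializationAt F E x)).finrank_eq

/-- At a fixed point of the involution the fibre embeds equivariantly into `ℍ^m`. -/
theorem exists_fiber_embedding [FiniteDimensional ℂ F] {l : ℕ} (hF : Module.finrank ℂ F = 2 * l) (hlm : l ≤ m) {p : J}
    (hp : ιJ p = p) :
    ∃ A : E p →ₗ[ℂ] QuatSpace m, Injective A ∧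
      ∀ Φ : ∀ x, E x →ₗ[ℂ] QuatSpace m, Φ p = A → Q.conj Φ p = A := by
  obtain ⟨j, hj⟩ : ∃ j : E p →ₛₗ[starRingEnd ℂ] E p,
      ∀ v, (⟨ιJ p, Q.fiberMap p v⟩ : TotalSpace F E) = ⟨p, j v⟩ := by
    -- `Q.fiberMap p` lands in the fibre over `ιJ p`; replacing `ιJ p` by a variable `y` allows the
    -- identification with `E p` by substitution.
    have h : ∀ (y : J) (_ : y = p) (f : E p →ₛₗ[starRingEnd ℂ] E y),
        ∃ j : E p →ₛₗ[starRingEnd ℂ] E p,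
          ∀ v, (⟨y, f v⟩ : TotalSpace F E) = ⟨p, j v⟩ := by
      rintro _ rfl f
      exact ⟨f, fun _ => rfl⟩
    exact h _ hp _
  have hjj (v : E p) : j (j v) = -v := by
    have h1 := Q.sq_eq_neg p v
    have h2 := congrArg Q.total (hj v)
    have h3 : (⟨p, j (j v)⟩ : TotalSpace F E) = ⟨p, -v⟩ := by
      rw [← hj, ← h1]
      exact h2.symm
    exact TotalSpace.mk_injective p h3
  have : FiniteDimensional ℂ (E p) := Module.Finite.equiv
    ((trivializationAt F E p).linearEquivAt ℂ p (mem_baseSet_trivializationAt F E p)).symm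
  obtain ⟨A, hA, hAj⟩ := exists_quaternionic_embedding j hjj
    ((finrank_fiber (F := F) p).trans hF) hlm
  refine ⟨A, hA, fun Φ hΦ => ?_⟩
  ext1 v
  have h := congrArg (fun u : TotalSpace F E => Φ u.proj u.2) (hj v)
  simp only at h
  rw [Q.conj_apply, h, hΦ, hAj, QuatSpace.mulJ_mulJ, neg_neg]

end Fiber

/-! ### Smooth approximation -/

section Approximation

open scoped Topology

/-- A continuous homomorphism is approximated near a compact part of the domain of a trivialization
by a smooth family of linear maps. -/
theorem exists_contMDiff_approx_localRep {k : ℕ} {J : Type*} [TopologicalSpace J] [T2Space J]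
    [CompactSpace J] [ChartedSpace (EuclideanSpace ℝ (Fin k)) J] [IsManifold (𝓡 k) ∞ J]
    {F : Type*} [NormedAddCommGroup F] [NormedSpace ℂ F] [FiniteDimensional ℂ F]
    {E : J → Type*} [∀ x, AddCommGroup (E x)] [∀ x, Module ℂ (E x)]
    [TopologicalSpace (TotalSpace F E)] {m : ℕ}
    {e : Trivialization F (π F E)} [e.IsLinear ℂ]
    {Φ : ∀ x, E x →ₗ[ℂ] QuatSpace m}
    (hΦ : Continuous (fun u : TotalSpace F E => Φ u.proj u.2))
    {T : Set J} (hT : IsClosed T) (hTe : T ⊆ e.baseSet) {ε : ℝ} (hε : 0 < ε) :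
    ∃ g : J → F →L[ℂ] QuatSpace m, ContMDiff (𝓡 k) 𝓘(ℝ, F →L[ℂ] QuatSpace m) ∞ g ∧
      ∀ x ∈ T, dist (g x) (localRep e Φ x) < ε := by
  classical
  -- The condition on `g x` is convex, and a constant satisfies it near each point, so a partition
  -- of unity glues the constants. Outside `T` nothing is required.
  let t : J → Set (F →L[ℂ] QuatSpace m) := fun x =>
    if x ∈ T then Metric.ball (localRep e Φ x) ε else Set.univ
  obtain ⟨g, hg⟩ := exists_contMDiffMap_forall_mem_convex_of_local_const (𝓡 k) (t := t)
    (n := (⊤ : ℕ∞)) (fun x => by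
      by_cases hx : x ∈ T
      · simpa only [t, if_pos hx] using convex_ball _ _
      · simpa only [t, if_neg hx] using convex_univ) (fun x => by
      by_cases hx : x ∈ T
      · have hc : ContinuousAt (localRep e Φ) x :=
          (continuousOn_localRep hΦ).continuousAt (e.open_baseSet.mem_nhds (hTe hx))
        refine ⟨localRep e Φ x, ?_⟩
        filter_upwards [Metric.continuousAt_iff'.1 hc ε hε] with y hy
        by_cases hyT : y ∈ T
        · simpa only [t, if_pos hyT, Metric.mem_ball, dist_comm] using hy
        · simp only [t, if_neg hyT, Set.mem_univ]
      · refine ⟨0, ?_⟩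
        filter_upwards [hT.isOpen_compl.mem_nhds hx] with y hy
        simp only [t, if_neg hy, Set.mem_univ])
  refine ⟨g, g.contMDiff, fun x hx => ?_⟩
  have h := hg x
  rwa [show t x = _ from if_pos hx] at h

end Approximation

/-! ### Equivariant homomorphisms -/

section Equivariant

open scoped Topology

variable {k : ℕ} {J : Type*} [TopologicalSpace J] [T2Space J]
  [ChartedSpace (EuclideanSpace ℝ (Fin k)) J] [IsManifold (𝓡 k) ∞ J]
  {ιJ : J → J} {F : Type*} [NormedAddCommGroup F] [NormedSpace ℂ F] [FiniteDimensional ℂ F]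
  {E : J → Type*} [∀ x, AddCommGroup (E x)] [∀ x, Module ℂ (E x)]
  [TopologicalSpace (TotalSpace F E)] [∀ x, TopologicalSpace (E x)] [FiberBundle F E]
  [VectorBundle ℂ F E] [VectorBundle ℝ F E] {n : WithTop ℕ∞} [ContMDiffVectorBundle n F E (𝓡 k)]
  {Q : QuaternionicStructure ιJ F E} {m : ℕ}

/-- Every linear map on the fibre at a point `p` extends to a homomorphism that
vanishes outside a given neighbourhood of `p`. -/
theorem exists_isContMDiffHom_extending (hn : n ≤ ∞) {p : J} {O : Set J} (hO : O ∈ 𝓝 p)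
    (A : E p →ₗ[ℂ] QuatSpace m) :
    ∃ Φ : ∀ x, E x →ₗ[ℂ] QuatSpace m,
      IsContMDiffHom k F n Φ ∧ Φ p = A ∧ ∀ x ∉ O, Φ x = 0 := by
  let e := trivializationAt F E p
  have hp : p ∈ e.baseSet := mem_baseSet_trivializationAt F E p
  obtain ⟨φ, -, hφ⟩ := (SmoothBumpFunction.nhds_basis_tsupport (I := 𝓡 k) p).mem_iff.1
    (Filter.inter_mem hO (e.open_baseSet.mem_nhds hp))
  refine ⟨fun x => φ x • ((LinearMap.toContinuousLinearMap (A ∘ₗ e.symmₗ ℂ p)).toLinearMap ∘ₗ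
    e.linearMapAt ℂ x), isContMDiffHom_smul_comp_linearMapAt e (φ.contMDiff.of_le hn)
    (hφ.trans Set.inter_subset_right) contMDiff_const, ?_, fun x hx => ?_⟩
  · ext1 v
    change φ p • A (e.symmₗ ℂ p (e.linearMapAt ℂ p v)) = A v
    rw [φ.eq_one, one_smul, e.symmₗ_linearMapAt hp]
  · have : φ x = 0 := image_eq_zero_of_notMem_tsupport fun h => hx (hφ h).1
    simp only [this, zero_smul]

variable [CompactSpace J]

/-- A compact discrete fixed point set is finite, so extensions of the fibre embeddings `A p` can be
chosen to vanish at the other fixed points. At `p` the symmetrised sum equals `2 A p`, which is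
still injective. -/
theorem exists_equivariant_injective_on_fixedPoints (hn : n ≤ ∞) (hc : Continuous ιJ)
    (hiso : IsDiscrete (fixedPoints ιJ))
    (hQ : ContMDiff ((𝓡 k).prod 𝓘(ℝ, F)) ((𝓡 k).prod 𝓘(ℝ, F)) n Q.total)
    {l : ℕ} (hF : Module.finrank ℂ F = 2 * l) (hlm : l ≤ m) :
    ∃ Φ : ∀ x, E x →ₗ[ℂ] QuatSpace m, IsContMDiffHom k F n Φ ∧ Q.conj Φ = Φ ∧
      ∀ x ∈ fixedPoints ιJ, Injective (Φ x) := by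
  have hfin : (fixedPoints ιJ).Finite := (isClosed_fixedPoints hc).isCompact.finite hiso
  choose A hA hAconj using fun p : fixedPoints ιJ =>
    exists_fiber_embedding (F := F) (E := E) (Q := Q) hF hlm p.2
  have hnhds (p : fixedPoints ιJ) : (fixedPoints ιJ \ {p.1})ᶜ ∈ 𝓝 p.1 :=
    (hfin.subset Set.sdiff_subset).isClosed.isOpen_compl.mem_nhds (by simp)
  choose Φ hΦ hΦA hΦ0 using fun p : fixedPoints ιJ =>
    exists_isContMDiffHom_extending (k := k) (F := F) hn (hnhds p) (A p)
  have : Fintype (fixedPoints ιJ) := hfin.fintype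
  let Ψ : ∀ x, E x →ₗ[ℂ] QuatSpace m := fun x => ∑ p, Φ p x
  have hΨ : IsContMDiffHom k F n Ψ := IsContMDiffHom.sum fun p _ => hΦ p
  have hΨA (q : fixedPoints ιJ) : Ψ q = A q := by
    rw [← hΦA q]
    refine Finset.sum_eq_single q (fun p _ hpq => hΦ0 p _ ?_) (by simp)
    rw [Set.notMem_compl_iff]
    exact ⟨q.2, fun h => hpq (Subtype.ext h.symm)⟩
  refine ⟨Ψ + Q.conj Ψ, hΨ.add (hΨ.conj hQ), ?_, fun x hx => ?_⟩
  · rw [Q.conj_add, Q.conj_conj, add_comm]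
  · refine (injective_iff_map_eq_zero _).2 fun v hv => ?_
    rw [Pi.add_apply, hAconj ⟨x, hx⟩ Ψ (hΨA ⟨x, hx⟩), hΨA ⟨x, hx⟩, LinearMap.add_apply,
      ← two_smul ℂ, smul_eq_zero_iff_right two_ne_zero] at hv
    exact (injective_iff_map_eq_zero _).1 (hA ⟨x, hx⟩) v hv

/-- Near a point that is not fixed by the involution, every equivariant homomorphism becomes
injective after an arbitrarily small equivariant perturbation. -/
theorem exists_nhds_forall_exists_perturbation (hn : n ≤ ∞) (hc : Continuous ιJ)
    (hinv : Involutive ιJ)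
    (hQ : ContMDiff ((𝓡 k).prod 𝓘(ℝ, F)) ((𝓡 k).prod 𝓘(ℝ, F)) n Q.total)
    (hdim : k + 2 * Module.finrank ℂ F < 4 * m + 2) {x₀ : J} (hx₀ : ιJ x₀ ≠ x₀) :
    -- `B` is chosen before `Φ` and `K`, so that finitely many such sets can be fixed first and
    -- treated in succession.
    ∃ B ∈ 𝓝 x₀, IsClosed B ∧ ∀ (Φ : ∀ x, E x →ₗ[ℂ] QuatSpace m) (K : Set J),
      IsContMDiffHom k F n Φ → Q.conj Φ = Φ → IsClosed K → (∀ x ∈ K, Injective (Φ x)) →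
      ∃ Φ' : ∀ x, E x →ₗ[ℂ] QuatSpace m, IsContMDiffHom k F n Φ' ∧ Q.conj Φ' = Φ' ∧
        ∀ x ∈ K ∪ B, Injective (Φ' x) := by
  let e := trivializationAt F E x₀
  have hx₀e : x₀ ∈ e.baseSet := mem_baseSet_trivializationAt F E x₀
  -- This makes the support of the bump function disjoint from its image under `ιJ`.
  obtain ⟨u, w, hu, hw, hx₀u, hx₀w, huw⟩ := t2_separation hx₀.symm
  have hV : u ∩ ιJ ⁻¹' w ∈ 𝓝 x₀ := (hu.inter (hw.preimage hc)).mem_nhds ⟨hx₀u, hx₀w⟩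
  obtain ⟨φ, -, hφ⟩ := (SmoothBumpFunction.nhds_basis_tsupport (I := 𝓡 k) x₀).mem_iff.1
    (Filter.inter_mem hV (e.open_baseSet.mem_nhds hx₀e))
  have hφe : tsupport φ ⊆ e.baseSet := hφ.trans Set.inter_subset_right
  have hφι {x : J} (hx : x ∈ tsupport φ) : φ (ιJ x) = 0 :=
    image_eq_zero_of_notMem_tsupport fun h =>
      Set.disjoint_left.1 huw (hφ h).1.1 (hφ hx).1.2
  let c := extChartAt (𝓡 k) x₀
  -- On this chart ball `φ = 1`; being convex, it is a legitimate parameter domain for the general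
  -- position lemma.
  let S : Set (EuclideanSpace ℝ (Fin k)) := Metric.ball (c x₀) φ.rIn
  have hS : S ⊆ c.target := fun y hy => φ.ball_subset
    ⟨Metric.ball_subset_ball φ.rIn_lt_rOut.le hy, by simp⟩
  have hN : c.source ∩ c ⁻¹' S ∈ 𝓝 x₀ :=
    Filter.inter_mem (extChartAt_source_mem_nhds x₀)
      ((continuousAt_extChartAt x₀).preimage_mem_nhds (Metric.ball_mem_nhds _ φ.rIn_pos))
  obtain ⟨B, hB, hBc, hBN⟩ := exists_mem_nhds_isClosed_subset hN
  have hφ1 {x : J} (hx : x ∈ B) : φ x = 1 :=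
    φ.one_of_dist_le (by simpa only [c, extChartAt_source] using (hBN hx).1) (hBN hx).2.le
  have hBφ {x : J} (hx : x ∈ B) : x ∈ tsupport φ :=
    subset_tsupport _ (by rw [mem_support, hφ1 hx]; exact one_ne_zero)
  refine ⟨B, hB, hBc, fun Φ K hΦ hΦe hK hΦK => ?_⟩
  -- The part of the symmetrised `K` on which the perturbation takes place.
  let T : Set J := (K ∪ ιJ ⁻¹' K) ∩ tsupport φ
  have hΦK' : ∀ x ∈ K ∪ ιJ ⁻¹' K, Injective (Φ x) := by
    rintro x (hx | hx)
    · exact hΦK x hx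
    · exact (QuaternionicStructure.injective_apply_iff hinv hΦe).1 (hΦK _ hx)
  have hT : IsCompact T :=
    ((hK.union (hK.preimage hc)).inter (isClosed_tsupport φ)).isCompact
  -- By compactness, one `ε` serves all of `T`: every linear map within `ε` of a local
  -- representative over `T` is injective. Half of `ε` is spent on smoothing, half on the
  -- translation by `A`.
  obtain ⟨ε, hε, hεT⟩ := (hT.image_of_continuousOn
    ((continuousOn_localRep hΦ.continuous_apply).mono
      (Set.inter_subset_right.trans hφe))).exists_thickening_subset_open
    (ContinuousLinearMap.isOpen_injective (𝕜 := ℂ) (E := F) (F := QuatSpace m)) (by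
      rintro _ ⟨x, hx, rfl⟩
      exact (injective_localRep_iff (hφe hx.2)).2 (hΦK' x hx.1))
  obtain ⟨g, hg, hgT⟩ := exists_contMDiff_approx_localRep (k := k) hΦ.continuous_apply
    (isClosed_tsupport φ) hφe (half_pos hε)
  have hgS : ContDiffOn ℝ 1 (g ∘ c.symm) S := by
    have h : ContMDiffOn 𝓘(ℝ, EuclideanSpace ℝ (Fin k)) 𝓘(ℝ, F →L[ℂ] QuatSpace m) ∞
        (g ∘ c.symm) S :=
      hg.comp_contMDiffOn ((contMDiffOn_extChartAt_symm x₀).mono hS)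
    exact h.contDiffOn.of_le (by exact_mod_cast le_top)
  obtain ⟨A, hA, hAε⟩ := (dense_setOf_forall_injective_add (convex_ball _ _) hgS (by
    rw [finrank_euclideanSpace_fin, QuatSpace.finrank_complex]; omega)).exists_dist_lt 0
      (half_pos hε)
  rw [dist_zero_left] at hAε
  -- In coordinates, adding `D` interpolates from `Φ` to the generic family `g + A`, which is
  -- reached where `φ = 1`.
  let D : ∀ x, E x →ₗ[ℂ] QuatSpace m :=
    (fun x => φ x • ((g x + A).toLinearMap ∘ₗ e.linearMapAt ℂ x)) - fun x => φ x • Φ x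
  have hφn : ContMDiff (𝓡 k) 𝓘(ℝ, ℝ) n φ := φ.contMDiff.of_le hn
  have hD : IsContMDiffHom k F n D :=
    (isContMDiffHom_smul_comp_linearMapAt e hφn hφe
      ((hg.of_le hn).add contMDiff_const)).sub (hΦ.smul hφn)
  have hD0 {x : J} (hx : φ x = 0) : D x = 0 := by
    simp only [D, Pi.sub_apply, hx, zero_smul, sub_zero]
  have hΦ'e : Q.conj (Φ + (D + Q.conj D)) = Φ + (D + Q.conj D) := by
    rw [Q.conj_add, Q.conj_add, Q.conj_conj, hΦe, add_comm (Q.conj D)]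
  have hΦ'x {x : J} (hx : φ (ιJ x) = 0) : (Φ + (D + Q.conj D)) x = Φ x + D x := by
    rw [Pi.add_apply, Pi.add_apply, QuaternionicStructure.conj_eq_zero (hD0 hx), add_zero]
  have hrep {x : J} (hx : x ∈ tsupport φ) : localRep e (Φ + (D + Q.conj D)) x =
      localRep e Φ x + φ x • (g x + A - localRep e Φ x) := by
    ext1 v
    rw [localRep_apply, hΦ'x (hφι hx)]
    change Φ x (e.symmₗ ℂ x v) + (φ x • (g x + A) (e.linearMapAt ℂ x (e.symmₗ ℂ x v))
      - φ x • Φ x (e.symmₗ ℂ x v)) =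
      Φ x (e.symmₗ ℂ x v) + φ x • ((g x + A) v - Φ x (e.symmₗ ℂ x v))
    rw [e.linearMapAt_symmₗ (hφe hx), smul_sub]
  have hinjT : ∀ x ∈ T, Injective ((Φ + (D + Q.conj D)) x) := by
    intro x hx
    refine (injective_localRep_iff (hφe hx.2)).1 (hεT (Metric.mem_thickening_iff.2
      ⟨_, Set.mem_image_of_mem _ hx, ?_⟩))
    rw [hrep hx.2, dist_eq_norm, add_sub_cancel_left, norm_smul, Real.norm_of_nonneg φ.nonneg]
    have h1 := hgT x hx.2
    rw [dist_eq_norm] at h1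
    have h2 : ‖g x + A - localRep e Φ x‖ < ε := by
      rw [add_sub_right_comm]
      exact (norm_add_le _ _).trans_lt (by linarith)
    exact (mul_le_of_le_one_left (norm_nonneg _) φ.le_one).trans_lt h2
  refine ⟨Φ + (D + Q.conj D), hΦ.add (hD.add (hD.conj hQ)), hΦ'e, ?_⟩
  rintro x (hx | hx)
  -- Over the support of `φ` the change is less than `ε`; over its mirror image injectivity is
  -- carried across by equivariance, which is why `T` involves `ιJ ⁻¹' K`; elsewhere `Φ` is
  -- unchanged.
  · by_cases h1 : x ∈ tsupport φ
    · exact hinjT x ⟨Or.inl hx, h1⟩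
    by_cases h2 : ιJ x ∈ tsupport φ
    · refine (QuaternionicStructure.injective_apply_iff hinv hΦ'e).1 (hinjT _ ⟨Or.inr ?_, h2⟩)
      rwa [Set.mem_preimage, hinv x]
    rw [hΦ'x (image_eq_zero_of_notMem_tsupport h2), hD0 (image_eq_zero_of_notMem_tsupport h1),
      add_zero]
    exact hΦK x hx
  · refine (injective_localRep_iff (hφe (hBφ hx))).1 ?_
    rw [hrep (hBφ hx), hφ1 hx, one_smul, add_sub_cancel]
    have h := hA (c x) (hBN hx).2
    rwa [comp_apply, c.left_inv (hBN hx).1] at h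

theorem exists_equivariant_injective (hn : n ≤ ∞) (hc : Continuous ιJ)
    (hinv : Involutive ιJ) (hiso : IsDiscrete (fixedPoints ιJ))
    (hQ : ContMDiff ((𝓡 k).prod 𝓘(ℝ, F)) ((𝓡 k).prod 𝓘(ℝ, F)) n Q.total)
    {l : ℕ} (hF : Module.finrank ℂ F = 2 * l) (hlm : l ≤ m) (hdim : k + 4 * l < 4 * m + 2) :
    ∃ Φ : ∀ x, E x →ₗ[ℂ] QuatSpace m, IsContMDiffHom k F n Φ ∧ Q.conj Φ = Φ ∧
      ∀ x, Injective (Φ x) := by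
  obtain ⟨Φ₀, hΦ₀, hΦ₀e, hΦ₀i⟩ :=
    exists_equivariant_injective_on_fixedPoints (m := m) hn hc hiso hQ hF hlm
  -- `L` is a compact neighbourhood of the fixed points on which injectivity already holds; it is
  -- kept inside every later `K`, so nothing need be done near fixed points.
  obtain ⟨L, hL, hfixL, hLi⟩ := exists_compact_between (isClosed_fixedPoints hc).isCompact
    (isOpen_setOf_injective hΦ₀.continuous_apply) hΦ₀i
  have key : ∀ (Φ : ∀ x, E x →ₗ[ℂ] QuatSpace m) (K : Set J),
      IsContMDiffHom k F n Φ → Q.conj Φ = Φ → IsClosed K → L ⊆ K → (∀ x ∈ K, Injective (Φ x)) →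
      ∃ (Φ' : ∀ x, E x →ₗ[ℂ] QuatSpace m) (K' : Set J), IsContMDiffHom k F n Φ' ∧
        Q.conj Φ' = Φ' ∧ IsClosed K' ∧ K ∪ Set.univ ⊆ K' ∧ ∀ x ∈ K', Injective (Φ' x) := by
    -- The property of `t` is that injectivity on any closed `K ⊇ L` can be enlarged to `K ∪ t`.
    -- Quantifying over all starting pairs `Φ`, `K` makes it stable under unions.
    refine isCompact_univ.induction_on (p := fun t => ∀ (Φ : ∀ x, E x →ₗ[ℂ] QuatSpace m)
      (K : Set J), IsContMDiffHom k F n Φ → Q.conj Φ = Φ → IsClosed K → L ⊆ K →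
      (∀ x ∈ K, Injective (Φ x)) →
      ∃ (Φ' : ∀ x, E x →ₗ[ℂ] QuatSpace m) (K' : Set J), IsContMDiffHom k F n Φ' ∧
        Q.conj Φ' = Φ' ∧ IsClosed K' ∧ K ∪ t ⊆ K' ∧ ∀ x ∈ K', Injective (Φ' x)) ?_ ?_ ?_ ?_
    · intro Φ K hΦ hΦe hK _ hi
      exact ⟨Φ, K, hΦ, hΦe, hK, by simp, hi⟩
    · intro s t hst ht Φ K hΦ hΦe hK hLK hi
      obtain ⟨Φ', K', h1, h2, h3, h4, h5⟩ := ht Φ K hΦ hΦe hK hLK hi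
      exact ⟨Φ', K', h1, h2, h3, (Set.union_subset_union_right K hst).trans h4, h5⟩
    · intro s t hs ht Φ K hΦ hΦe hK hLK hi
      obtain ⟨Φ', K', h1, h2, h3, h4, h5⟩ := hs Φ K hΦ hΦe hK hLK hi
      have hKK' : K ⊆ K' := Set.subset_union_left.trans h4
      obtain ⟨Φ'', K'', h1', h2', h3', h4', h5'⟩ := ht Φ' K' h1 h2 h3 (hLK.trans hKK') h5
      refine ⟨Φ'', K'', h1', h2', h3', ?_, h5'⟩
      rw [← Set.union_assoc]
      exact (Set.union_subset_union_left t h4).trans h4'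
    · intro x _
      rw [nhdsWithin_univ]
      by_cases hx : ιJ x = x
      · refine ⟨L, mem_interior_iff_mem_nhds.1 (hfixL hx), ?_⟩
        intro Φ K hΦ hΦe hK hLK hi
        exact ⟨Φ, K, hΦ, hΦe, hK, Set.union_subset subset_rfl hLK, hi⟩
      · obtain ⟨B, hB, hBc, h⟩ := exists_nhds_forall_exists_perturbation (k := k) (n := n)
          (Q := Q) (m := m) hn hc hinv hQ (by omega) hx
        refine ⟨B, hB, fun Φ K hΦ hΦe hK hLK hi => ?_⟩
        obtain ⟨Φ', h1, h2, h3⟩ := h Φ K hΦ hΦe hK hi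
        exact ⟨Φ', K ∪ B, h1, h2, hK.union hBc, subset_rfl, h3⟩
  obtain ⟨Φ, K, hΦ, hΦe, -, hK, hi⟩ := key Φ₀ L hΦ₀ hΦ₀e hL.isClosed subset_rfl hLi
  exact ⟨Φ, hΦ, hΦe, fun x => hi x (hK (Or.inr trivial))⟩


end Equivariant

/-- Equivariance under `U(1)` is complex linearity, and equivariance under `ι` is invariance under
`Q.conj`. -/
theorem isPin2Monomorphism_of_conj_eq {k : ℕ} {J : Type*} [TopologicalSpace J]
    [ChartedSpace (EuclideanSpace ℝ (Fin k)) J]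
    {ιJ : J → J} (hc : Continuous ιJ) (hinv : Involutive ιJ)
    {F : Type*} [NormedAddCommGroup F] [NormedSpace ℂ F]
    {E : J → Type*} [∀ x, AddCommGroup (E x)] [∀ x, Module ℂ (E x)]
    [TopologicalSpace (TotalSpace F E)] [∀ x, TopologicalSpace (E x)] [FiberBundle F E]
    {Q : QuaternionicStructure ιJ F E} {m : ℕ} {n : WithTop ℕ∞}
    {Φ : ∀ x, E x →ₗ[ℂ] QuatSpace m} (hΦ : IsContMDiffHom k F n Φ) (hΦe : Q.conj Φ = Φ)
    (hi : ∀ x, Injective (Φ x)) :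
    IsPin2Monomorphism Q (trivialQuaternionic ιJ hc hinv m)
      (fun x => (Φ x : E x →ₗ[ℂ] Bundle.Trivial J (QuatSpace m) x)) where
  continuous := (contMDiff_totalMap_iff.2 hΦ).continuous
  injective := hi
  equivariant := by
    rintro (z | z) ⟨x, v⟩
    · change (⟨x, Φ x ((z : ℂ) • v)⟩ : TotalSpace (QuatSpace m) (Bundle.Trivial J (QuatSpace m)))
        = ⟨x, (z : ℂ) • Φ x v⟩
      rw [map_smul]
    · change (⟨ιJ x, Φ (ιJ x) ((z : ℂ) • Q.fiberMap x v)⟩ :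
          TotalSpace (QuatSpace m) (Bundle.Trivial J (QuatSpace m)))
        = ⟨ιJ x, (z : ℂ) • QuatSpace.mulJ m (Φ x v)⟩
      rw [map_smul, QuaternionicStructure.apply_fiberMap hΦe]

theorem theorem2p11
    (k l : ℕ)
    {J : Type*} [TopologicalSpace J] [T2Space J] [CompactSpace J]
    [ChartedSpace (EuclideanSpace ℝ (Fin k)) J] [IsManifold (𝓡 k) ∞ J]
    (ιJ : J → J) (hsmooth : ContMDiff (𝓡 k) (𝓡 k) ∞ ιJ) (hinv : Involutive ιJ)
    (hne : (fixedPoints ιJ).Nonempty) (hiso : IsDiscrete (fixedPoints ιJ))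
    {F : Type*} [NormedAddCommGroup F] [NormedSpace ℂ F] [FiniteDimensional ℂ F]
    (hF : Module.finrank ℂ F = 2 * l)
    {E : J → Type*} [∀ x, AddCommGroup (E x)] [∀ x, Module ℂ (E x)]
    [TopologicalSpace (TotalSpace F E)] [∀ x, TopologicalSpace (E x)]
    [FiberBundle F E] [VectorBundle ℂ F E]
    (Q : QuaternionicStructure ιJ F E)
    (m : ℕ) (hm : m = l + (k + 2) / 4) :
    -- a topological bundle has a continuous monomorphism
    (∃ Φ : ∀ x, E x →ₗ[ℂ] Bundle.Trivial J (QuatSpace m) x,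
      IsPin2Monomorphism Q (trivialQuaternionic ιJ hsmooth.continuous hinv m) Φ) ∧
    -- a smooth bundle has a smooth monomorphism
    (IsSmoothComplexBundle k F E →
      ContMDiff ((𝓡 k).prod 𝓘(ℝ, F)) ((𝓡 k).prod 𝓘(ℝ, F)) ∞ Q.total →
      ∃ Φ : ∀ x, E x →ₗ[ℂ] Bundle.Trivial J (QuatSpace m) x,
        IsPin2Monomorphism Q (trivialQuaternionic ιJ hsmooth.continuous hinv m) Φ ∧
        ContMDiff ((𝓡 k).prod 𝓘(ℝ, F)) ((𝓡 k).prod 𝓘(ℝ, QuatSpace m)) ∞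
          (totalMap F (QuatSpace m) Φ)) := by
  have : VectorBundle ℝ F E := vectorBundle_real_of_complex F E
  have hlm : l ≤ m := by omega
  -- Equivalent to `k + 2 < 4 (⌊(k + 2) / 4⌋ + 1)`.
  have hdim : k + 4 * l < 4 * m + 2 := by omega
  have hc := hsmooth.continuous
  refine ⟨?_, fun hE hQ => ?_⟩
  -- A topological bundle with continuous `ι_E` is the case `n = 0`.
  · obtain ⟨Φ, hΦ, hΦe, hi⟩ := exists_equivariant_injective (k := k) (n := 0) (Q := Q) (m := m)
      zero_le hc hinv hiso (contMDiff_zero_iff.2 Q.continuous_total) hF hlm hdim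
    exact ⟨_, isPin2Monomorphism_of_conj_eq hc hinv hΦ hΦe hi⟩
  · have : ContMDiffVectorBundle ∞ F E (𝓡 k) := hE
    obtain ⟨Φ, hΦ, hΦe, hi⟩ := exists_equivariant_injective (k := k) (n := ∞) (Q := Q) (m := m)
      le_rfl hc hinv hiso hQ hF hlm hdim
    exact ⟨_, isPin2Monomorphism_of_conj_eq hc hinv hΦ hΦe hi, contMDiff_totalMap_iff.2 hΦ⟩
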